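/- **Theorem 4.3 (with Remark 4.4(i)).** Let $d\ge 1$. There is a free, rank-one, infinite measure preserving action $T=(T_\gamma)_{\gamma\in\mathbb Z^d}$ of $\mathbb Z^d$ on a $\sigma$-finite standard measure space $(X,\mathfrak B,\mu)$ such that $\mathcal R(T)=P(\mathbb R^d)$. Moreover, there is a free, rank-one, infinite measure preserving action $T$ of $\mathbb Z^d$ on such a space with $\mathcal Ri(T)=P(\mathbb R^d)$. Here $P(\mathbb R^d)$ is the set of lines through the origin in $\mathbb R^d$, $\operatorname{dist}$ is the Euclidean distance, and: * $T$ is *infinite measure preserving* if every $T_\gamma$ preserves $\mu$ and $\mu(X)=\infty$; it is *free* if $T_\gamma x\ne x$ for all $x\in X$ and $\gamma\ne0$. * $T$ is of *rank one* if there are measurable sets $A_n$ of finite measure and cubes $F_n=\{0,\dots,h_n-1\}^d\subset\mathbb Z^d$ such that for each $n$ the sets $T_\gamma A_n$, $\gamma\in F_n$, are pairwise disjoint, and for each measurable $B$ with $\mu(B)<\infty$ one has $\min_{J\subset F_n}\mu\bigl(B\,\triangle\,\bigcup_{\gamma\in J}T_\gamma A_n\bigr)\to0$ as $n\to\infty$.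 * $\mathcal R(T)$ is the set of $\theta\in P(\mathbb R^d)$ along which $T$ is *recurrent*: for each $\epsilon>0$ and each measurable $A$ with $\mu(A)>0$ there are $\gamma\in\mathbb Z^d\setminus\{0\}$ and $g\in\theta$ with $\operatorname{dist}(\gamma,g)<\epsilon$ and $\mu(A\cap T_\gamma A)>0$. * $\mathcal Ri(T)$ is the set of $\theta\in P(\mathbb R^d)$ along which $T$ is *rigid*: there is a sequence $(\gamma_n)_{n\ge1}$ in $\mathbb Z^d$ with $\gamma_n\to\infty$, $\inf_{g\in\theta}\operatorname{dist}(\gamma_n,g)\to0$, and $\mu(A\cap T_{\gamma_n}A)\to\mu(A)$ for each measurable $A$ with $\mu(A)<\infty$. -/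

import Mathlib

open MeasureTheory Filter Topology
open scoped symmDiff

/-! Measure preserving actions of `ℤ^d` are Mathlib's additive actions of `Fin d → ℤ` by measurable
maps (`MeasurableConstVAdd`) which leave a measure invariant (`VAddInvariantMeasure`);
`T_γ x` is `γ +ᵥ x`. -/

namespace DirectionalRecurrence

/-- The projective space `P(ℝ^d)` of lines through the origin in Euclidean space. -/
abbrev Directions (d : ℕ) : Type :=
  Projectivization ℝ (EuclideanSpace ℝ (Fin d))

/-- A lattice point of `ℤ^d`, regarded as a vector of Euclidean space `ℝ^d`. -/
noncomputable def latticePoint {d : ℕ} (γ : Fin d → ℤ) : EuclideanSpace ℝ (Fin d) :=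
  WithLp.toLp 2 (fun i => (γ i : ℝ))

/-- The image `T_γ A` of a set under the element `γ` of `ℤ^d`. -/
def translateSet {d : ℕ} {X : Type*} [AddAction (Fin d → ℤ) X] (γ : Fin d → ℤ) (A : Set X) : Set X :=
  (fun x => γ +ᵥ x) '' A

/-- The action is free: only `0` has a fixed point. -/
def IsFreeAction (d : ℕ) (X : Type*) [AddAction (Fin d → ℤ) X] : Prop :=
  ∀ (γ : Fin d → ℤ) (x : X), γ +ᵥ x = x → γ = 0

/-- The cube `{0, …, h - 1}^d` in `ℤ^d`. -/
noncomputable def cube (d h : ℕ) : Finset (Fin d → ℤ) :=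
  Fintype.piFinset (fun _ => Finset.Ico (0 : ℤ) (h : ℤ))

/-- The action is of rank one: there is a sequence of Rokhlin towers, with bases `A n` of finite
measure and with pairwise disjoint levels `T_γ (A n)` indexed by the points `γ` of a cube, such that
every set of finite measure is approximated by unions of levels of the `n`-th tower as `n → ∞`.
(Using cubes with a corner at `0` is no restriction: translating the cube amounts to
replacing the base by one of its translates.) -/
def IsRankOne (d : ℕ) {X : Type*} [MeasurableSpace X] [AddAction (Fin d → ℤ) X]
    (μ : Measure X) : Prop :=
  ∃ (A : ℕ → Set X) (h : ℕ → ℕ),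
    (∀ n, MeasurableSet (A n) ∧ μ (A n) < ⊤) ∧
    (∀ n, (cube d (h n) : Set (Fin d → ℤ)).PairwiseDisjoint (fun γ => translateSet γ (A n))) ∧
    ∀ B : Set X, MeasurableSet B → μ B < ⊤ → ∀ ε : ENNReal, 0 < ε →
      ∀ᶠ n in atTop, ∃ J : Finset (Fin d → ℤ), J ⊆ cube d (h n) ∧
        μ (B ∆ ⋃ γ ∈ J, translateSet γ (A n)) < ε

/-- The action is recurrent along the line `θ`. -/
def IsRecurrentAlong {d : ℕ} {X : Type*} [MeasurableSpace X] [AddAction (Fin d → ℤ) X]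
    (μ : Measure X) (θ : Directions d) : Prop :=
  ∀ ε : ℝ, 0 < ε → ∀ A : Set X, MeasurableSet A → 0 < μ A →
    ∃ γ : Fin d → ℤ, γ ≠ 0 ∧ (∃ g ∈ θ.submodule, dist (latticePoint γ) g < ε) ∧
      0 < μ (A ∩ translateSet γ A)

/-- The action is rigid along the line `θ`: there is a sequence `γ n → ∞` in `ℤ^d` whose distance to
`θ` tends to `0` and with `μ (A ∩ T_{γ n} A) → μ A` for all `A` of finite measure. -/
def IsRigidAlong {d : ℕ} {X : Type*} [MeasurableSpace X] [AddAction (Fin d → ℤ) X]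
    (μ : Measure X) (θ : Directions d) : Prop :=
  ∃ γ : ℕ → (Fin d → ℤ),
    Tendsto γ atTop cofinite ∧
    Tendsto (fun n => Metric.infDist (latticePoint (γ n))
      (θ.submodule : Set (EuclideanSpace ℝ (Fin d)))) atTop (𝓝 0) ∧
    ∀ A : Set X, MeasurableSet A → μ A < ⊤ →
      Tendsto (fun n => μ (A ∩ translateSet (γ n) A)) atTop (𝓝 (μ A))

/-- The set `R(T)` of recurrent directions. -/
def recurrentDirections (d : ℕ) {X : Type*} [MeasurableSpace X] [AddAction (Fin d → ℤ) X]
    (μ : Measure X) : Set (Directions d) :=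
  {θ | IsRecurrentAlong μ θ}

/-- The set `Ri(T)` of rigid directions. -/
def rigidDirections (d : ℕ) {X : Type*} [MeasurableSpace X] [AddAction (Fin d → ℤ) X]
    (μ : Measure X) : Set (Directions d) :=
  {θ | IsRigidAlong μ θ}

end DirectionalRecurrence

/-! One action serves both claims, since a rigid direction is recurrent
(`IsRigidAlong.isRecurrentAlong`). It is built by cutting and stacking inside a product of the
finite groups `(ℤ/m n)^d`, on which `ℤ^d` acts diagonally. The `n`-th tower is indexed by a cube `F
n` of side about `2 m n / 3`, and its copies in the next tower are placed at the points `m n • t`,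
where `t` runs through a cube of side `l n`.

Rigidity in all directions at once rests on Dirichlet's theorem being uniform in the direction
(`exists_bound_int_vector_near_line`). Once `m n` is known, there is a radius `R` such that every
line has a nonzero lattice point `p` with entries at most `R` and within `1 / ((n + 1) m n)` of the
line. Then `m n • p` is within `1 / (n + 1)` of the line. Taking `l n` much larger than `R`
(`exists_cube_almost_invariant`), translation by `m n • p` carries all but a fraction `1 / (n + 1)`
of the copies of the `n`-th tower onto copies. So unions of levels of the `n`-th tower are almost
invariant (`measure_biUnion_level_diff_le`). Such unions approximate every set of finite measure
(`eventually_exists_symmDiff_lt`), which gives rank one and extends rigidity to all these sets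
(`tendsto_measure_inter_translateSet`).

The copies fill only about `3^(-d)` of the next tower, so the total measure is infinite. Shifting
the `n`-th tower by an element of `F n` keeps it inside the next tower; this yields invariance
(`map_stageMeasure_le`). Freeness holds at every point because distinct elements of `F n` are
incongruent modulo `m n` and each `γ` lies in some `F n`. -/

namespace DirectionalRecurrence

/-! ### Lattice points near lines -/

/-- Dirichlet's theorem on simultaneous approximation, uniformly in the direction `v`. -/
theorem exists_int_vector_near_multiple {d : ℕ} (N : ℕ) (hN : 2 ≤ N) (v : Fin d → ℝ)
    (hv : ∀ i, |v i| ≤ 1) (hv1 : ∃ i, |v i| = 1) :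
    ∃ (p : Fin d → ℤ) (t : ℝ), p ≠ 0 ∧ (∀ i, |p i| ≤ (N ^ d + 1 : ℕ)) ∧
      ∀ i, |t * v i - p i| ≤ 1 / N := by
  have hN0 : (0 : ℝ) < N := by positivity
  have hcell : ∀ x : ℝ, ⌊Int.fract x * N⌋₊ < N := fun x => by
    rw [Nat.floor_lt (by positivity [Int.fract_nonneg x])]
    nlinarith [Int.fract_lt_one x]
  -- Pigeonhole: the `N ^ d + 1` multiples `k • v`, taken modulo 1, fall into `N ^ d` small cubes of
  -- side `1 / N`. Two of them share a cube, and their difference is close to an integer vector.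
  let cell : Fin (N ^ d + 1) → Fin d → Fin N := fun k i => ⟨⌊Int.fract ((k : ℝ) * v i) * N⌋₊, hcell _⟩
  obtain ⟨k, l, hkl, hcl⟩ := Fintype.exists_ne_map_eq_of_card_lt cell (by simp)
  wlog hlt : k < l generalizing k l
  · exact this l k hkl.symm hcl.symm (lt_of_le_of_ne (not_lt.mp hlt) hkl.symm)
  have hlt' : (k : ℝ) + 1 ≤ l := by exact_mod_cast hlt
  have hl : (l : ℝ) ≤ (N : ℝ) ^ d := by exact_mod_cast Nat.lt_succ_iff.mp l.2
  have hk0 : (0 : ℝ) ≤ (k : ℕ) := by positivity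
  have key : ∀ i, |((l : ℝ) - k) * v i - ((⌊(l : ℝ) * v i⌋ - ⌊(k : ℝ) * v i⌋ : ℤ) : ℝ)| ≤ 1 / N := by
    intro i
    have h1 : ⌊Int.fract ((k : ℝ) * v i) * N⌋₊ = ⌊Int.fract ((l : ℝ) * v i) * N⌋₊ := by
      simpa [cell] using congrArg Fin.val (congrFun hcl i)
    have hk1 := Nat.floor_le (a := Int.fract ((k : ℝ) * v i) * N)
      (by positivity [Int.fract_nonneg ((k : ℝ) * v i)])
    have hk2 := Nat.lt_floor_add_one (Int.fract ((k : ℝ) * v i) * N)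
    have hl1 := Nat.floor_le (a := Int.fract ((l : ℝ) * v i) * N)
      (by positivity [Int.fract_nonneg ((l : ℝ) * v i)])
    have hl2 := Nat.lt_floor_add_one (Int.fract ((l : ℝ) * v i) * N)
    rw [h1] at hk1 hk2
    have e : ((l : ℝ) - k) * v i - ((⌊(l : ℝ) * v i⌋ - ⌊(k : ℝ) * v i⌋ : ℤ) : ℝ) =
        Int.fract ((l : ℝ) * v i) - Int.fract ((k : ℝ) * v i) := by
      simp only [Int.fract]; push_cast; ring
    rw [e, le_div_iff₀ hN0, ← abs_of_pos hN0, ← abs_mul, abs_le]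
    constructor <;> nlinarith
  refine ⟨fun i => ⌊(l : ℝ) * v i⌋ - ⌊(k : ℝ) * v i⌋, (l : ℝ) - k, ?_, ?_, key⟩
  -- If `p = 0`, the coordinate with `|v i| = 1` would give `l - k ≤ 1 / N < 1`.
  · intro h0
    obtain ⟨i, hi⟩ := hv1
    have h2 := key i
    have h3 : (⌊(l : ℝ) * v i⌋ - ⌊(k : ℝ) * v i⌋ : ℤ) = 0 := congrFun h0 i
    rw [h3, Int.cast_zero, sub_zero, abs_mul, hi, mul_one, abs_of_pos (by linarith),
      le_div_iff₀ hN0] at h2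
    have : (2 : ℝ) ≤ N := by exact_mod_cast hN
    nlinarith
  · intro i
    have h2 := key i
    have hN1 : (1 : ℝ) / N ≤ 1 := by
      rw [div_le_one hN0]; exact_mod_cast (by omega : 1 ≤ N)
    have h4 : |((l : ℝ) - k) * v i| ≤ (N : ℝ) ^ d := by
      rw [abs_mul, abs_of_pos (by linarith)]
      nlinarith [hv i, abs_nonneg (v i)]
    have h5 : |((⌊(l : ℝ) * v i⌋ - ⌊(k : ℝ) * v i⌋ : ℤ) : ℝ)| ≤ (N : ℝ) ^ d + 1 := by
      rw [abs_le] at *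
      constructor <;> linarith
    exact_mod_cast h5

/-- Every line through the origin has a nonzero lattice point in its `ε`-neighbourhood, of a size
which can be bounded independently of the line. -/
theorem exists_bound_int_vector_near_line (d : ℕ) {ε : ℝ} (hε : 0 < ε) :
    ∃ R : ℕ, ∀ θ : Directions d, ∃ p : Fin d → ℤ, p ≠ 0 ∧ (∀ i, |p i| ≤ R) ∧
      ∃ g ∈ θ.submodule, dist (latticePoint p) g ≤ ε := by
  -- Coordinate errors of at most `1 / N` give a Euclidean error of at most `√d / N ≤ d / N < ε`.
  obtain ⟨N, hN⟩ := exists_nat_gt (max 2 (d / ε))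
  have hN2 : 2 ≤ N := by
    have := (le_max_left 2 ((d : ℝ) / ε)).trans hN.le
    exact_mod_cast this
  have hNd : (d : ℝ) / ε < N := (le_max_right _ _).trans_lt hN
  have hN0 : (0 : ℝ) < N := by positivity
  refine ⟨N ^ d + 1, fun θ => ?_⟩
  have hθ := θ.rep_nonzero
  have hmem : θ.rep ∈ θ.submodule := by
    rw [Projectivization.submodule_eq]; exact Submodule.mem_span_singleton_self _
  set u : Fin d → ℝ := fun i => θ.rep i with hu
  obtain ⟨j, hj⟩ : ∃ j, u j ≠ 0 := by
    by_contra! h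
    exact hθ (by ext i; exact h i)
  -- Normalising the direction in the sup norm makes the bound `N ^ d + 1` independent of the line.
  obtain ⟨i₀, -, hi₀⟩ := Finset.exists_max_image Finset.univ (fun i => |u i|) ⟨j, Finset.mem_univ _⟩
  have hpos : 0 < |u i₀| := (abs_pos.mpr hj).trans_le (hi₀ j (Finset.mem_univ _))
  obtain ⟨p, t, hp0, hpR, hp⟩ := exists_int_vector_near_multiple N hN2 (fun i => u i / |u i₀|)
    (fun i => by
      rw [abs_div, abs_abs, div_le_one hpos]; exact hi₀ i (Finset.mem_univ _))
    ⟨i₀, by rw [abs_div, abs_abs, div_self hpos.ne']⟩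
  refine ⟨p, hp0, hpR, (t / |u i₀|) • θ.rep, Submodule.smul_mem _ _ hmem, ?_⟩
  have hbd : ∀ i, dist (latticePoint p i) (((t / |u i₀|) • θ.rep) i) ≤ 1 / N := by
    intro i
    rw [dist_comm, Real.dist_eq]
    have : ((t / |u i₀|) • θ.rep) i - latticePoint p i = t * (u i / |u i₀|) - p i := by
      simp [latticePoint, hu]; ring
    rw [this]; exact hp i
  rw [EuclideanSpace.dist_eq]
  refine (Real.sqrt_le_sqrt (Finset.sum_le_sum fun i _ =>
    pow_le_pow_left₀ dist_nonneg (hbd i) 2)).trans ?_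
  rw [Finset.sum_const, Finset.card_univ, Fintype.card_fin, nsmul_eq_mul]
  refine Real.sqrt_le_iff.mpr ⟨hε.le, ?_⟩
  rw [div_lt_iff₀ hε] at hNd
  rw [one_div, inv_pow, ← div_eq_mul_inv, div_le_iff₀ (by positivity)]
  rcases Nat.eq_zero_or_pos d with rfl | hd
  · simp; positivity
  · have : (1 : ℝ) ≤ d := by exact_mod_cast hd
    calc (d : ℝ) ≤ d * d := by nlinarith
      _ ≤ (N * ε) * (N * ε) := by gcongr
      _ = _ := by ring

/-! ### Boxes -/

theorem card_cube (d L : ℕ) : (cube d L).card = L ^ d := by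
  simp [cube, Fintype.card_piFinset]

/-- A large cube is almost invariant under a bounded translation. -/
theorem exists_cube_almost_invariant (d R q : ℕ) :
    ∃ L : ℕ, 0 < L ∧ ∀ p : Fin d → ℤ, (∀ i, |p i| ≤ R) →
      q * ((cube d L).filter (fun t => t - p ∉ cube d L)).card ≤ (cube d L).card := by
  -- A point `t` with `t - p` outside the cube has a coordinate in one of `d` slabs of thickness at
  -- most `R`, a fraction at most `d R / L` of the cube.
  refine ⟨q * (d * R) + 1, by positivity, fun p hp => ?_⟩
  set L := q * (d * R) + 1 with hL
  have hmem : ∀ t : Fin d → ℤ, t ∈ cube d L ↔ ∀ i, 0 ≤ t i ∧ t i < L := by simp [cube]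
  let s : Fin d → Finset (Fin d → ℤ) := fun i => Fintype.piFinset
    (Function.update (fun _ => Finset.Ico (0 : ℤ) L) i
      ((Finset.Ico (0 : ℤ) L).filter fun t => t - p i ∉ Finset.Ico (0 : ℤ) L))
  have hsub : (cube d L).filter (fun t => t - p ∉ cube d L) ⊆ Finset.univ.biUnion s := by
    intro t ht
    rw [Finset.mem_filter] at ht
    obtain ⟨h1, h2⟩ := ht
    simp only [hmem, not_forall, Pi.sub_apply] at h1 h2
    obtain ⟨i, hi⟩ := h2
    simp only [Finset.mem_biUnion, Finset.mem_univ, true_and]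
    refine ⟨i, ?_⟩
    simp only [s, Fintype.mem_piFinset]
    intro j
    by_cases hj : j = i
    · subst hj
      simp only [Function.update_self, Finset.mem_filter, Finset.mem_Ico]
      exact ⟨h1 j, hi⟩
    · simp only [Function.update_of_ne hj, Finset.mem_Ico]
      exact h1 j
  have hcard : ∀ i, (s i).card * L ≤ R * L ^ d := by
    intro i
    have h1 : ((Finset.Ico (0 : ℤ) L).filter fun t => t - p i ∉ Finset.Ico (0 : ℤ) L).card ≤ R := by
      have hpi := abs_le.mp (hp i)
      rcases le_total 0 (p i) with h0 | h0
      · calc _ ≤ (Finset.Ico (0 : ℤ) R).card := Finset.card_le_card fun t ht => by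
              simp only [Finset.mem_filter, Finset.mem_Ico] at ht ⊢; omega
          _ = R := by simp
      · calc _ ≤ (Finset.Ico ((L : ℤ) - R) L).card := Finset.card_le_card fun t ht => by
              simp only [Finset.mem_filter, Finset.mem_Ico] at ht ⊢; omega
          _ = R := by simp
    have h2 : (s i).card = ((Finset.Ico (0 : ℤ) L).filter
        fun t => t - p i ∉ Finset.Ico (0 : ℤ) L).card * L ^ (d - 1) := by
      rw [Fintype.card_piFinset, ← Finset.mul_prod_erase _ _ (Finset.mem_univ i),
        Function.update_self]
      congr 1
      rw [Finset.prod_congr rfl (g := fun _ => L)]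
      · simp
      · intro j hj
        rw [Function.update_of_ne (Finset.ne_of_mem_erase hj)]; simp
    rw [h2, mul_assoc, ← pow_succ, Nat.sub_add_cancel (by have := i.2; omega)]
    exact Nat.mul_le_mul_right _ h1
  have h3 : ((cube d L).filter (fun t => t - p ∉ cube d L)).card * L ≤ d * R * L ^ d :=
    calc _ ≤ (∑ i, (s i).card) * L :=
          Nat.mul_le_mul_right _ ((Finset.card_le_card hsub).trans Finset.card_biUnion_le)
      _ = ∑ i, (s i).card * L := Finset.sum_mul _ _ _
      _ ≤ ∑ _i : Fin d, R * L ^ d := Finset.sum_le_sum fun i _ => hcard i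
      _ = _ := by simp [mul_assoc]
  rw [card_cube]
  refine Nat.le_of_mul_le_mul_right (c := L) ?_ (by positivity)
  calc _ ≤ q * (d * R * L ^ d) := by rw [mul_assoc]; exact Nat.mul_le_mul_left _ h3
    _ = (q * (d * R)) * L ^ d := by ring
    _ ≤ L * L ^ d := Nat.mul_le_mul_right _ (by omega)
    _ = _ := mul_comm _ _

/-! ### Translates of sets -/

section Translate

variable {d : ℕ} {X : Type*} [AddAction (Fin d → ℤ) X]

theorem mem_translateSet {γ : Fin d → ℤ} {A : Set X} {x : X} :
    x ∈ translateSet γ A ↔ -γ +ᵥ x ∈ A := by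
  constructor
  · rintro ⟨y, hy, rfl⟩
    simpa [vadd_vadd] using hy
  · intro h
    exact ⟨_, h, by simp⟩

theorem translateSet_eq_preimage (γ : Fin d → ℤ) (A : Set X) :
    translateSet γ A = (fun x => -γ +ᵥ x) ⁻¹' A :=
  Set.ext fun _ => mem_translateSet

theorem translateSet_translateSet (γ δ : Fin d → ℤ) (A : Set X) :
    translateSet γ (translateSet δ A) = translateSet (γ + δ) A := by
  ext x
  simp [mem_translateSet, vadd_vadd, neg_add_rev]

theorem measurableSet_translateSet [MeasurableSpace X] [MeasurableConstVAdd (Fin d → ℤ) X]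
    {A : Set X} (hA : MeasurableSet A) (γ : Fin d → ℤ) : MeasurableSet (translateSet γ A) := by
  rw [translateSet_eq_preimage]
  exact measurable_const_vadd (-γ) hA

theorem measure_translateSet [MeasurableSpace X] [MeasurableConstVAdd (Fin d → ℤ) X]
    (μ : Measure X) [VAddInvariantMeasure (Fin d → ℤ) X μ] (A : Set X) (γ : Fin d → ℤ) :
    μ (translateSet γ A) = μ A := by
  rw [translateSet_eq_preimage]
  exact measure_preimage_vadd μ (-γ) A

end Translate

/-! ### The limit of an increasing sequence of measures -/

/-- The limit is the sum of the increments `ρ (k + 1) - ρ k`, whose partial sums telescope.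
Finiteness makes the subtraction of measures reversible. -/
theorem exists_measure_eq_iSup {X : Type*} [MeasurableSpace X] (ρ : ℕ → Measure X)
    [∀ n, IsFiniteMeasure (ρ n)] (hρ : ∀ n, ρ n ≤ ρ (n + 1)) :
    ∃ μ : Measure X, ∀ B, MeasurableSet B → μ B = ⨆ n, ρ n B := by
  let δ : ℕ → Measure X := fun n => Nat.casesOn n (ρ 0) fun k => ρ (k + 1) - ρ k
  have hsum : ∀ n (B : Set X), ∑ k ∈ Finset.range (n + 1), δ k B = ρ n B := by
    intro n B
    induction n with
    | zero => simp [δ]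
    | succ n ih =>
      rw [Finset.sum_range_succ, ih, add_comm, ← Measure.add_apply]
      exact congrArg (fun ν : Measure X => ν B) (Measure.sub_add_cancel_of_le (hρ n))
  refine ⟨Measure.sum δ, fun B hB => ?_⟩
  rw [Measure.sum_apply _ hB, ENNReal.tsum_eq_iSup_nat' (tendsto_add_atTop_nat 1)]
  exact iSup_congr fun n => hsum n B

/-! ### Resampling one coordinate of a product measure -/

/-- The uniform distribution on a finite set. -/
noncomputable def uniformMeasure {α : Type*} [MeasurableSpace α] (s : Finset α) : Measure α :=
  (s.card : ENNReal)⁻¹ • ∑ a ∈ s, Measure.dirac a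

theorem uniformMeasure_apply {α : Type*} [MeasurableSpace α] (s : Finset α) (t : Set α) :
    uniformMeasure s t = (s.card : ENNReal)⁻¹ * ∑ a ∈ s, Measure.dirac a t := by
  simp [uniformMeasure]

theorem isProbabilityMeasure_uniformMeasure {α : Type*} [MeasurableSpace α] {s : Finset α}
    (hs : s.Nonempty) : IsProbabilityMeasure (uniformMeasure s) := by
  constructor
  rw [uniformMeasure_apply]
  simp only [measure_univ, Finset.sum_const, nsmul_eq_mul, mul_one]
  exact ENNReal.inv_mul_cancel (by simpa using hs.ne_empty) (by simp)

/-- Replacing the `n`-th coordinate by an independent uniform choice does not change the product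
measure, as is checked on finite-dimensional boxes. This is what splits the base of a tower into
equally weighted pieces. -/
theorem infinitePi_uniformMeasure_eq_sum {α : Type*} [MeasurableSpace α] (s : ℕ → Finset α)
    (hs : ∀ k, (s k).Nonempty) (n : ℕ) :
    Measure.infinitePi (fun k => uniformMeasure (s k)) =
      ((s n).card : ENNReal)⁻¹ • ∑ c ∈ s n,
        (Measure.infinitePi (fun k => uniformMeasure (s k))).map (fun y => Function.update y n c) := by
  classical
  have : ∀ k, IsProbabilityMeasure (uniformMeasure (s k)) :=
    fun k => isProbabilityMeasure_uniformMeasure (hs k)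
  symm
  apply Measure.eq_infinitePi
  intro I t ht
  have hupd : ∀ c, Measurable (fun y : ℕ → α => Function.update y n c) := fun c =>
    measurable_update_left
  have hcomp : ∀ c, (fun y : ℕ → α => Function.update y n c) ⁻¹' Set.pi I t =
      {_y | n ∈ I → c ∈ t n} ∩ Set.pi (I.erase n : Finset ℕ) t := by
    intro c
    ext y
    simp only [Set.mem_preimage, Set.mem_pi, Finset.mem_coe, Set.mem_inter_iff, Set.mem_ofPred_eq,
      Finset.mem_erase]
    constructor
    · intro h
      refine ⟨fun hn => by simpa using h n hn, fun i hi => ?_⟩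
      simpa [hi.1] using h i hi.2
    · rintro ⟨h1, h2⟩ i hi
      by_cases hin : i = n
      · subst hin; simpa using h1 hi
      · simpa [hin] using h2 i ⟨hin, hi⟩
  have hval : ∀ c, (Measure.infinitePi (fun k => uniformMeasure (s k))).map
      (fun y => Function.update y n c) (Set.pi I t) =
      (if n ∈ I then Measure.dirac c (t n) else 1) *
        ∏ i ∈ I.erase n, uniformMeasure (s i) (t i) := by
    intro c
    rw [Measure.map_apply (hupd c) (MeasurableSet.pi I.countable_toSet fun i _ => ht i), hcomp]
    by_cases hn : n ∈ I
    · by_cases hc : c ∈ t n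
      · simp [-Finset.coe_erase, hn, hc, Measure.infinitePi_pi _ (fun i _ => ht i),
          Measure.dirac_apply' _ (ht n)]
      · simp [hn, hc, Measure.dirac_apply' _ (ht n)]
    · simp [-Finset.coe_erase, hn, Measure.infinitePi_pi _ (fun i _ => ht i)]
  simp only [Measure.smul_apply, Measure.finsetSum_apply, hval, smul_eq_mul]
  rw [← Finset.sum_mul, ← mul_assoc]
  by_cases hn : n ∈ I
  · simp only [hn, if_true]
    rw [← uniformMeasure_apply, Finset.mul_prod_erase I (fun i => uniformMeasure (s i) (t i)) hn]
  · simp only [hn, if_false, Finset.sum_const, nsmul_eq_mul, mul_one]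
    rw [ENNReal.inv_mul_cancel (by simpa using (hs n).ne_empty) (by simp), one_mul,
      Finset.erase_eq_of_notMem hn]

/-! ### Cutting and stacking inside an odometer -/

/-- The data of a cutting and stacking construction of an action of `ℤ^d`: the `n`-th tower has
shape `F n`, it is cut into pieces indexed by `C n`, and the piece indexed by `c` becomes the part
`F n + c` of the tower of shape `F (n + 1)`. The divisibility conditions make this a
construction inside of the odometer of the subgroups `m n • ℤ^d`. -/
structure TowerData (d : ℕ) where
  m : ℕ → ℕ
  C : ℕ → Finset (Fin d → ℤ)
  F : ℕ → Finset (Fin d → ℤ)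
  nonempty_C : ∀ n, (C n).Nonempty
  zero_mem_F : ∀ n, 0 ∈ F n
  dvd_m : ∀ {k n}, k ≤ n → m k ∣ m n
  dvd_C : ∀ {n c}, c ∈ C n → ∀ i, (m n : ℤ) ∣ c i
  eq_of_dvd : ∀ {n f g}, f ∈ F n → g ∈ F n → (∀ i, (m n : ℤ) ∣ f i - g i) → f = g
  -- The extra summand `f` leaves room for a shift: with `f = 0` this says that the copies fit into
  -- the next tower, with general `f` that they still do after translation by `f`.
  add_mem_F : ∀ {n f g c}, f ∈ F n → g ∈ F n → c ∈ C n → f + (g + c) ∈ F (n + 1)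
  eventually_mem_F : ∀ γ, ∀ᶠ n in atTop, γ ∈ F n
  -- A level of tower `n` has measure `1 / ∏ k < n, |C k|`, so this makes the measures of the towers
  -- unbounded.
  exists_mul_prod_card_le : ∀ q : ℕ, ∃ n, q * ∏ k ∈ Finset.range n, (C k).card ≤ (F n).card

namespace TowerData

variable {d : ℕ} (D : TowerData d)

/-- The space on which the action is constructed. -/
def Space : Type := (n : ℕ) → Fin d → ZMod (D.m n)

noncomputable instance : AddCommGroup D.Space :=
  inferInstanceAs (AddCommGroup ((n : ℕ) → Fin d → ZMod (D.m n)))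

instance : TopologicalSpace D.Space :=
  inferInstanceAs (TopologicalSpace ((n : ℕ) → Fin d → ZMod (D.m n)))

instance : T2Space D.Space :=
  inferInstanceAs (T2Space ((n : ℕ) → Fin d → ZMod (D.m n)))

instance : MeasurableSpace D.Space :=
  inferInstanceAs (MeasurableSpace ((n : ℕ) → Fin d → ZMod (D.m n)))

instance countable_zmod (n : ℕ) : Countable (ZMod n) := by
  cases n with
  | zero => exact inferInstanceAs (Countable ℤ)
  | succ n => exact inferInstanceAs (Countable (Fin (n + 1)))

instance borelSpace_zmod (n : ℕ) : BorelSpace (ZMod n) :=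
  ⟨borel_eq_top_of_discrete.symm⟩

instance : BorelSpace D.Space :=
  inferInstanceAs (BorelSpace ((n : ℕ) → Fin d → ZMod (D.m n)))

instance : StandardBorelSpace D.Space :=
  inferInstanceAs (StandardBorelSpace ((n : ℕ) → Fin d → ZMod (D.m n)))

/-- The diagonal embedding of `ℤ^d`. -/
def embed : (Fin d → ℤ) →+ D.Space where
  toFun γ := fun _ i => (γ i : ZMod _)
  map_zero' := by
    funext n i
    exact Int.cast_zero
  map_add' γ δ := by
    funext n i
    exact Int.cast_add _ _

noncomputable instance : AddAction (Fin d → ℤ) D.Space where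
  vadd γ x := D.embed γ + x
  zero_vadd x := by
    change D.embed 0 + x = x
    rw [map_zero, zero_add]
  add_vadd γ δ x := by
    change D.embed (γ + δ) + x = D.embed γ + (D.embed δ + x)
    rw [map_add, add_assoc]

theorem vadd_apply (γ : Fin d → ℤ) (x : D.Space) (n : ℕ) (i : Fin d) :
    (γ +ᵥ x) n i = (γ i : ZMod (D.m n)) + x n i := rfl

theorem continuous_vadd (γ : Fin d → ℤ) : Continuous (fun x : D.Space => γ +ᵥ x) := by
  refine continuous_pi fun n => continuous_pi fun i => ?_
  change Continuous fun x : D.Space => (γ i : ZMod (D.m n)) + x n i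
  exact continuous_const.add
    ((continuous_apply i).comp (continuous_apply (A := fun n => Fin d → ZMod (D.m n)) n))

instance : MeasurableConstVAdd (Fin d → ℤ) D.Space :=
  ⟨fun γ => (D.continuous_vadd γ).measurable⟩

theorem isFreeAction : IsFreeAction d D.Space := by
  intro γ x h
  obtain ⟨n, hn⟩ := (D.eventually_mem_F γ).exists
  refine D.eq_of_dvd hn (D.zero_mem_F n) fun i => ?_
  have h1 := congrFun (congrFun h n) i
  rw [vadd_apply, add_eq_right, ZMod.intCast_zmod_eq_zero_iff_dvd] at h1
  simpa using h1

/-- The point of the odometer with the given digits in places `n, n + 1, …`, and digits `0` in the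
previous places. -/
def tail (n : ℕ) (y : ℕ → Fin d → ℤ) : D.Space :=
  fun j i => ((∑ k ∈ Finset.Ico n j, y k i : ℤ) : ZMod (D.m j))

theorem continuous_tail (n : ℕ) : Continuous (D.tail n) := by
  refine continuous_pi fun j => continuous_pi fun i => ?_
  change Continuous fun y : ℕ → Fin d → ℤ => ((∑ k ∈ Finset.Ico n j, y k i : ℤ) : ZMod (D.m j))
  exact continuous_of_discreteTopology.comp (by fun_prop)

theorem tail_update (n : ℕ) (y : ℕ → Fin d → ℤ) (c : Fin d → ℤ) :
    D.tail (n + 1) (Function.update y n c) = D.tail (n + 1) y := by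
  funext j i
  simp only [tail]
  congr 1
  refine Finset.sum_congr rfl fun k hk => ?_
  rw [Function.update_of_ne]
  have := (Finset.mem_Ico.mp hk).1
  omega

/-- The digit `y n` enters the coordinates `j > n` as the first summand. In the coordinates `j ≤ n`
it vanishes, being divisible by `m n` and hence by `m j`. -/
theorem tail_eq_vadd (n : ℕ) {y : ℕ → Fin d → ℤ} (hy : y n ∈ D.C n) :
    D.tail n y = y n +ᵥ D.tail (n + 1) y := by
  funext j i
  rw [vadd_apply]
  simp only [tail]
  rcases lt_or_ge n j with h | h
  · rw [Finset.sum_eq_sum_Ico_succ_bot h, Int.cast_add]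
  · rw [Finset.Ico_eq_empty_of_le h, Finset.Ico_eq_empty_of_le (h.trans n.le_succ)]
    have : (y n i : ZMod (D.m j)) = 0 := by
      rw [ZMod.intCast_zmod_eq_zero_iff_dvd]
      exact (Int.natCast_dvd_natCast.mpr (D.dvd_m h)).trans (D.dvd_C hy i)
    simp [this]

/-- The base of the `n`-th tower. -/
def base (n : ℕ) : Set D.Space :=
  D.tail n '' Set.pi Set.univ fun k => (D.C k : Set (Fin d → ℤ))

/-- The base is defined as an image; compactness is what makes it measurable. -/
theorem isCompact_base (n : ℕ) : IsCompact (D.base n) :=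
  (isCompact_univ_pi fun k => (D.C k).finite_toSet.isCompact).image (D.continuous_tail n)

theorem measurableSet_base (n : ℕ) : MeasurableSet (D.base n) :=
  (D.isCompact_base n).isClosed.measurableSet

theorem base_eq_iUnion (n : ℕ) :
    D.base n = ⋃ c ∈ D.C n, translateSet c (D.base (n + 1)) := by
  ext x
  simp only [Set.mem_iUnion, exists_prop]
  constructor
  · rintro ⟨y, hy, rfl⟩
    exact ⟨y n, hy n trivial, _, ⟨y, hy, rfl⟩, (D.tail_eq_vadd n (hy n trivial)).symm⟩
  · rintro ⟨c, hc, _, ⟨y, hy, rfl⟩, rfl⟩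
    refine ⟨Function.update y n c, fun k _ => ?_, ?_⟩
    · by_cases hk : k = n
      · subst hk; simpa using hc
      · simpa [hk] using hy k trivial
    · rw [D.tail_eq_vadd n (by simpa using hc), D.tail_update, Function.update_self]

/-- The level of the `n`-th tower with index `f`. -/
def level (n : ℕ) (f : Fin d → ℤ) : Set D.Space := translateSet f (D.base n)

theorem translateSet_level (n : ℕ) (γ f : Fin d → ℤ) :
    translateSet γ (D.level n f) = D.level n (γ + f) :=
  translateSet_translateSet γ f _

theorem measurableSet_level (n : ℕ) (f : Fin d → ℤ) : MeasurableSet (D.level n f) :=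
  measurableSet_translateSet (D.measurableSet_base n) f

theorem level_eq_iUnion (n : ℕ) (f : Fin d → ℤ) :
    D.level n f = ⋃ c ∈ D.C n, D.level (n + 1) (f + c) := by
  rw [level, D.base_eq_iUnion n, translateSet, Set.image_iUnion₂]
  exact Set.iUnion₂_congr fun c _ => D.translateSet_level (n + 1) f c

/-- The tail contributes an empty sum to the coordinates `j ≤ n`. Hence a level determines these
coordinates, and coordinate `n` determines the level among those with index in `F n`. -/
theorem apply_eq_of_mem_level {n : ℕ} {f : Fin d → ℤ} {x : D.Space} (hx : x ∈ D.level n f)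
    {j : ℕ} (hj : j ≤ n) (i : Fin d) : x j i = (f i : ZMod (D.m j)) := by
  obtain ⟨_, ⟨y, -, rfl⟩, rfl⟩ := hx
  change (f +ᵥ D.tail n y) j i = _
  rw [vadd_apply, tail, Finset.Ico_eq_empty_of_le hj]
  simp

theorem eq_of_mem_level {n : ℕ} {f g : Fin d → ℤ} (hf : f ∈ D.F n) (hg : g ∈ D.F n)
    {x : D.Space} (hxf : x ∈ D.level n f) (hxg : x ∈ D.level n g) : f = g := by
  refine D.eq_of_dvd hf hg fun i => ?_
  have h := (D.apply_eq_of_mem_level hxf le_rfl i).symm.trans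
    (D.apply_eq_of_mem_level hxg le_rfl i)
  rw [← ZMod.intCast_zmod_eq_zero_iff_dvd, Int.cast_sub, h, sub_self]

theorem add_mem_F' {n : ℕ} {f c : Fin d → ℤ} (hf : f ∈ D.F n) (hc : c ∈ D.C n) :
    f + c ∈ D.F (n + 1) := by
  simpa using D.add_mem_F (D.zero_mem_F n) hf hc

theorem add_eq_add_iff {n : ℕ} {f f' c c' : Fin d → ℤ} (hf : f ∈ D.F n) (hf' : f' ∈ D.F n)
    (hc : c ∈ D.C n) (hc' : c' ∈ D.C n) (h : f + c = f' + c') : f = f' ∧ c = c' := by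
  have : f = f' := D.eq_of_dvd hf hf' fun i => by
    have h1 : f i - f' i = c' i - c i := by
      have := congrFun h i
      simp only [Pi.add_apply] at this
      linarith
    rw [h1]
    exact dvd_sub (D.dvd_C hc' i) (D.dvd_C hc i)
  subst this
  exact ⟨rfl, add_left_cancel h⟩

/-! ### The measure -/

/-- The distribution of a random point of the base of the `n`-th tower. -/
noncomputable def baseMeasure (n : ℕ) : Measure D.Space :=
  (Measure.infinitePi fun k => uniformMeasure (D.C k)).map (D.tail n)

instance (k : ℕ) : IsProbabilityMeasure (uniformMeasure (D.C k)) :=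
  isProbabilityMeasure_uniformMeasure (D.nonempty_C k)

instance (n : ℕ) : IsProbabilityMeasure (D.baseMeasure n) :=
  Measure.isProbabilityMeasure_map (D.continuous_tail n).measurable.aemeasurable

theorem baseMeasure_base (n : ℕ) : D.baseMeasure n (D.base n) = 1 := by
  rw [baseMeasure, Measure.map_apply (D.continuous_tail n).measurable (D.measurableSet_base n)]
  refine le_antisymm prob_le_one ?_
  calc (1 : ENNReal) = Measure.infinitePi (fun k => uniformMeasure (D.C k))
        (Set.pi Set.univ fun k => (D.C k : Set (Fin d → ℤ))) := by
        rw [Measure.infinitePi_pi_univ _ fun k => (D.C k).measurableSet]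
        have : ∀ k, uniformMeasure (D.C k) (D.C k : Set (Fin d → ℤ)) = 1 := fun k => by
          rw [uniformMeasure_apply, Finset.sum_congr rfl (g := fun _ => 1)]
          · simp only [Finset.sum_const, nsmul_eq_mul, mul_one]
            exact ENNReal.inv_mul_cancel (by simpa using (D.nonempty_C k).ne_empty) (by simp)
          · intro c hc
            rw [Measure.dirac_apply, Set.indicator_of_mem (by simpa using hc), Pi.one_apply]
        simp [this]
    _ ≤ _ := measure_mono (Set.subset_preimage_image _ _)

/-- Resampling the digit in place `n` turns the tail from `n` into a uniformly chosen translate of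
the tail from `n + 1`. -/
theorem baseMeasure_eq_sum (n : ℕ) :
    D.baseMeasure n = ((D.C n).card : ENNReal)⁻¹ • ∑ c ∈ D.C n,
      (D.baseMeasure (n + 1)).map (fun x => c +ᵥ x) := by
  have hm := fun n => (D.continuous_tail n).measurable
  conv_lhs => rw [baseMeasure, infinitePi_uniformMeasure_eq_sum D.C D.nonempty_C n]
  rw [Measure.map_smul]
  congr 1
  rw [← Measure.mapₗ_apply_of_measurable (hm n), map_sum]
  refine Finset.sum_congr rfl fun c hc => ?_
  rw [Measure.mapₗ_apply_of_measurable (hm n), Measure.map_map (hm n) measurable_update_left,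
    baseMeasure, Measure.map_map (measurable_const_vadd c) (hm _)]
  congr 1
  funext y
  simp only [Function.comp]
  rw [D.tail_eq_vadd n (by simpa using hc), D.tail_update, Function.update_self]

/-- The common measure of the levels of the `n`-th tower. -/
noncomputable def weight (n : ℕ) : ENNReal := (∏ k ∈ Finset.range n, ((D.C k).card : ENNReal))⁻¹

theorem weight_ne_top (n : ℕ) : D.weight n ≠ ⊤ := by
  rw [weight, Ne, ENNReal.inv_eq_top, Finset.prod_eq_zero_iff]
  rintro ⟨k, -, hk⟩
  exact (D.nonempty_C k).ne_empty (by simpa using hk)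

theorem card_ne_zero (n : ℕ) : ((D.C n).card : ENNReal) ≠ 0 := by
  simpa using (D.nonempty_C n).ne_empty

theorem weight_eq_mul_inv (n : ℕ) :
    D.weight (n + 1) = D.weight n * ((D.C n).card : ENNReal)⁻¹ := by
  rw [weight, Finset.prod_range_succ, ENNReal.mul_inv (Or.inr (by simp))
    (Or.inr (D.card_ne_zero n)), weight]

theorem card_mul_weight (n : ℕ) : (D.C n).card * D.weight (n + 1) = D.weight n := by
  rw [weight_eq_mul_inv, mul_left_comm, ENNReal.mul_inv_cancel (D.card_ne_zero n) (by simp),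
    mul_one]

/-- The measure carried by the `n`-th tower. -/
noncomputable def stageMeasure (n : ℕ) : Measure D.Space :=
  D.weight n • ∑ f ∈ D.F n, (D.baseMeasure n).map (fun x => f +ᵥ x)

instance (n : ℕ) : IsFiniteMeasure (D.stageMeasure n) :=
  Measure.smul_finite _ (D.weight_ne_top n)

/-- Cut into pieces of the next stage, the shifted tower measure is a sum over the indices `γ + (f +
c)`. These are distinct and lie in `F (n + 1)`, so it is a partial sum of `stageMeasure (n + 1)`.
The case `γ = 0` gives monotonicity in `n`, the general case invariance of the limit. -/
theorem map_stageMeasure_le {n : ℕ} {γ : Fin d → ℤ} (hγ : γ ∈ D.F n) :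
    (D.stageMeasure n).map (fun x => γ +ᵥ x) ≤ D.stageMeasure (n + 1) := by
  classical
  have hm : ∀ γ : Fin d → ℤ, Measurable fun x : D.Space => γ +ᵥ x := measurable_const_vadd
  have hmap : ∀ (γ δ : Fin d → ℤ) (ν : Measure D.Space),
      (ν.map (fun x => δ +ᵥ x)).map (fun x => γ +ᵥ x) = ν.map (fun x => (γ + δ) +ᵥ x) := by
    intro γ δ ν
    rw [Measure.map_map (hm γ) (hm δ)]
    congr 1
    funext x
    simp [vadd_vadd]
  have hmapsum : ∀ (γ : Fin d → ℤ) (s : Finset (Fin d → ℤ)) (ν : (Fin d → ℤ) → Measure D.Space),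
      (∑ c ∈ s, ν c).map (fun x => γ +ᵥ x) = ∑ c ∈ s, (ν c).map (fun x => γ +ᵥ x) := by
    intro γ s ν
    rw [← Measure.mapₗ_apply_of_measurable (hm γ), map_sum]
    exact Finset.sum_congr rfl fun c _ => Measure.mapₗ_apply_of_measurable (hm γ) _
  have hexp : (D.stageMeasure n).map (fun x => γ +ᵥ x) =
      D.weight (n + 1) • ∑ q ∈ D.F n ×ˢ D.C n,
        (D.baseMeasure (n + 1)).map (fun x => (γ + (q.1 + q.2)) +ᵥ x) := by
    rw [stageMeasure, Measure.map_smul, hmapsum, weight_eq_mul_inv, mul_smul,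
      Finset.sum_product, Finset.smul_sum (r := ((D.C n).card : ENNReal)⁻¹)]
    congr 1
    refine Finset.sum_congr rfl fun f _ => ?_
    rw [hmap, D.baseMeasure_eq_sum n, Measure.map_smul, hmapsum]
    congr 1
    refine Finset.sum_congr rfl fun c _ => ?_
    rw [hmap, add_assoc]
  rw [hexp, stageMeasure, Measure.le_iff']
  intro B
  simp only [Measure.smul_apply, Measure.finsetSum_apply, smul_eq_mul]
  refine mul_le_mul_right ?_ _
  rw [← Finset.sum_image (f := fun g => (D.baseMeasure (n + 1)).map (fun x => g +ᵥ x) B)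
    (g := fun q : (Fin d → ℤ) × (Fin d → ℤ) => γ + (q.1 + q.2))]
  · refine Finset.sum_le_sum_of_subset fun g hg => ?_
    obtain ⟨q, hq, rfl⟩ := Finset.mem_image.mp hg
    obtain ⟨h1, h2⟩ := Finset.mem_product.mp hq
    exact D.add_mem_F hγ h1 h2
  · intro q hq r hr h
    obtain ⟨h1, h2⟩ := Finset.mem_product.mp hq
    obtain ⟨h3, h4⟩ := Finset.mem_product.mp hr
    obtain ⟨h5, h6⟩ := D.add_eq_add_iff h1 h3 h2 h4 (add_left_cancel h)
    exact Prod.ext h5 h6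

theorem stageMeasure_mono : Monotone D.stageMeasure := by
  refine monotone_nat_of_le_succ fun n => ?_
  simpa using D.map_stageMeasure_le (D.zero_mem_F n)

/-- The invariant measure. -/
noncomputable def measure : Measure D.Space :=
  (exists_measure_eq_iSup D.stageMeasure fun n => D.stageMeasure_mono n.le_succ).choose

theorem measure_apply {B : Set D.Space} (hB : MeasurableSet B) :
    D.measure B = ⨆ n, D.stageMeasure n B :=
  (exists_measure_eq_iSup D.stageMeasure fun n => D.stageMeasure_mono n.le_succ).choose_spec B hB

theorem measure_preimage_vadd_le (γ : Fin d → ℤ) {B : Set D.Space} (hB : MeasurableSet B) :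
    D.measure ((fun x => γ +ᵥ x) ⁻¹' B) ≤ D.measure B := by
  have hm : Measurable fun x : D.Space => γ +ᵥ x := measurable_const_vadd γ
  rw [D.measure_apply (hm hB), D.measure_apply hB]
  refine iSup_le fun n => ?_
  obtain ⟨N, hN, hnN⟩ := ((D.eventually_mem_F γ).and (eventually_ge_atTop n)).exists
  calc D.stageMeasure n ((fun x => γ +ᵥ x) ⁻¹' B)
      ≤ D.stageMeasure N ((fun x => γ +ᵥ x) ⁻¹' B) := D.stageMeasure_mono hnN _
    _ = (D.stageMeasure N).map (fun x => γ +ᵥ x) B := (Measure.map_apply hm hB).symm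
    _ ≤ D.stageMeasure (N + 1) B := D.map_stageMeasure_le hN B
    _ ≤ _ := le_iSup (fun n => D.stageMeasure n B) (N + 1)

instance : VAddInvariantMeasure (Fin d → ℤ) D.Space D.measure := by
  -- The inequality for `-γ`, applied to the preimage under `γ`, is the reverse inequality.
  refine ⟨fun γ B hB => le_antisymm (D.measure_preimage_vadd_le γ hB) ?_⟩
  have hm : Measurable fun x : D.Space => γ +ᵥ x := measurable_const_vadd γ
  have h := D.measure_preimage_vadd_le (-γ) (hm hB)
  rw [← Set.preimage_comp] at h
  simpa [Function.comp_def, vadd_vadd] using h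

end TowerData

/-- Measurable sets of a countable product are approximated by sets which depend on finitely many
coordinates only. -/
theorem exists_symmDiff_determined_lt {Y : ℕ → Type*} [∀ n, MeasurableSpace (Y n)]
    (ρ : Measure (∀ n, Y n)) [IsFiniteMeasure ρ] {B : Set (∀ n, Y n)}
    (hB : MeasurableSet B) {ε : ENNReal} (hε : 0 < ε) :
    ∃ (E : Set (∀ n, Y n)) (j : ℕ), (∀ x y : ∀ n, Y n, (∀ i ≤ j, x i = y i) → x ∈ E → y ∈ E) ∧
      ρ (B ∆ E) < ε := by
  obtain ⟨E, hE, hlt⟩ := exists_measure_symmDiff_lt_of_generateFrom_isSetRing (μ := ρ)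
    (C := measurableCylinders Y) isSetRing_measurableCylinders
    ⟨{Set.univ}, Set.countable_singleton _,
      Set.singleton_subset_iff.mpr (univ_mem_measurableCylinders Y), by simp⟩
    generateFrom_measurableCylinders.symm hB hε
  rw [measurableCylinders_nat] at hE
  simp only [Set.mem_iUnion, Set.mem_singleton_iff, exists_prop] at hE
  obtain ⟨j, S, -, rfl⟩ := hE
  refine ⟨_, j, fun x y hxy hx => ?_, by rwa [symmDiff_comm]⟩
  have : (Finset.Iic j).restrict x = (Finset.Iic j).restrict y := by
    funext i
    exact hxy i (Finset.mem_Iic.mp i.2)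
  rw [mem_cylinder] at hx ⊢
  rwa [← this]

namespace TowerData

variable {d : ℕ} (D : TowerData d)

/-! ### The towers -/

theorem map_baseMeasure_level_self (n : ℕ) (f : Fin d → ℤ) :
    (D.baseMeasure n).map (fun x => f +ᵥ x) (D.level n f) = 1 := by
  rw [Measure.map_apply (measurable_const_vadd f) (D.measurableSet_level n f)]
  refine le_antisymm prob_le_one ?_
  rw [← D.baseMeasure_base n]
  exact measure_mono fun x hx => ⟨x, hx, rfl⟩

theorem map_baseMeasure_eq_zero {n : ℕ} {f : Fin d → ℤ} {B : Set D.Space}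
    (h : Disjoint B (D.level n f)) : (D.baseMeasure n).map (fun x => f +ᵥ x) B = 0 := by
  have h1 : (D.baseMeasure n).map (fun x => f +ᵥ x) (D.level n f)ᶜ = 0 := by
    have : IsProbabilityMeasure ((D.baseMeasure n).map (fun x => f +ᵥ x)) :=
      Measure.isProbabilityMeasure_map (measurable_const_vadd f).aemeasurable
    rw [prob_compl_eq_zero_iff (D.measurableSet_level n f)]
    exact D.map_baseMeasure_level_self n f
  exact measure_mono_null h.subset_compl_right h1

theorem stageMeasure_level {n : ℕ} {f : Fin d → ℤ} (hf : f ∈ D.F n) :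
    D.stageMeasure n (D.level n f) = D.weight n := by
  rw [stageMeasure, Measure.smul_apply, Measure.finsetSum_apply, smul_eq_mul,
    Finset.sum_eq_single f, D.map_baseMeasure_level_self n f, mul_one]
  · intro g hg hgf
    refine D.map_baseMeasure_eq_zero ?_
    rw [Set.disjoint_left]
    exact fun x hxf hxg => hgf (D.eq_of_mem_level hg hf hxg hxf)
  · exact fun h => absurd hf h

/-- Downward induction on the tower: a level splits into `|C k|` levels of the next tower.
Subadditivity suffices, as the opposite bound comes from `stageMeasure_level`. -/
theorem stageMeasure_level_le {k n : ℕ} (hkn : k ≤ n) :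
    ∀ {f : Fin d → ℤ}, f ∈ D.F k → D.stageMeasure n (D.level k f) ≤ D.weight k := by
  induction hkn using Nat.decreasingInduction with
  | self => exact fun hf => (D.stageMeasure_level hf).le
  | of_succ k hk ih =>
    intro f hf
    rw [D.level_eq_iUnion k f, ← D.card_mul_weight k, ← nsmul_eq_mul]
    exact (measure_biUnion_finset_le _ _).trans
      (Finset.sum_le_card_nsmul _ _ _ fun c hc => ih (D.add_mem_F' hf hc))

theorem measure_level {n : ℕ} {f : Fin d → ℤ} (hf : f ∈ D.F n) :
    D.measure (D.level n f) = D.weight n := by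
  rw [D.measure_apply (D.measurableSet_level n f)]
  refine le_antisymm (iSup_le fun k => ?_) ?_
  · exact (D.stageMeasure_mono (le_max_left k n) _).trans
      (D.stageMeasure_level_le (le_max_right k n) hf)
  · rw [← D.stageMeasure_level hf]
    exact le_iSup (fun k => D.stageMeasure k (D.level n f)) n

theorem measure_base (n : ℕ) : D.measure (D.base n) = D.weight n := by
  rw [← D.measure_level (D.zero_mem_F n), level, measure_translateSet]

theorem pairwiseDisjoint_level (n : ℕ) :
    (D.F n : Set (Fin d → ℤ)).PairwiseDisjoint (D.level n) := by
  intro f hf g hg hfg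
  rw [Function.onFun, Set.disjoint_left]
  exact fun x hxf hxg => hfg (D.eq_of_mem_level hf hg hxf hxg)

theorem measure_biUnion_level {n : ℕ} {J : Finset (Fin d → ℤ)} (hJ : J ⊆ D.F n) :
    D.measure (⋃ f ∈ J, D.level n f) = J.card * D.weight n := by
  rw [measure_biUnion_finset ((D.pairwiseDisjoint_level n).subset (by exact_mod_cast hJ))
    fun f _ => D.measurableSet_level n f,
    Finset.sum_congr rfl fun f hf => D.measure_level (hJ hf)]
  simp

/-- The union of the levels of the `n`-th tower. -/
def tower (n : ℕ) : Set D.Space := ⋃ f ∈ D.F n, D.level n f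

theorem measurableSet_tower (n : ℕ) : MeasurableSet (D.tower n) :=
  Finset.measurableSet_biUnion _ fun f _ => D.measurableSet_level n f

theorem measure_tower (n : ℕ) : D.measure (D.tower n) = (D.F n).card * D.weight n :=
  D.measure_biUnion_level subset_rfl

theorem measure_tower_ne_top (n : ℕ) : D.measure (D.tower n) ≠ ⊤ := by
  rw [measure_tower]
  exact ENNReal.mul_ne_top (by simp) (D.weight_ne_top n)

theorem tower_mono : Monotone D.tower := by
  refine monotone_nat_of_le_succ fun n => ?_
  refine Set.iUnion₂_subset fun f hf => ?_
  rw [D.level_eq_iUnion n f]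
  exact Set.iUnion₂_subset fun c hc =>
    Set.subset_biUnion_of_mem (u := D.level (n + 1)) (D.add_mem_F' hf hc)

theorem measure_compl_iUnion_tower : D.measure (⋃ n, D.tower n)ᶜ = 0 := by
  have hm : MeasurableSet (⋃ n, D.tower n)ᶜ :=
    (MeasurableSet.iUnion D.measurableSet_tower).compl
  rw [D.measure_apply hm, ENNReal.iSup_eq_zero]
  intro n
  rw [stageMeasure, Measure.smul_apply, Measure.finsetSum_apply, smul_eq_mul,
    Finset.sum_eq_zero, mul_zero]
  intro f hf
  refine D.map_baseMeasure_eq_zero (Set.disjoint_compl_left_iff_subset.mpr ?_)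
  exact (Set.subset_biUnion_of_mem (u := D.level n) hf).trans (Set.subset_iUnion D.tower n)

theorem measure_univ_eq_top : D.measure Set.univ = ⊤ := by
  refine ENNReal.eq_top_of_forall_nnreal_le fun r => ?_
  obtain ⟨q, hq⟩ := exists_nat_ge r
  obtain ⟨n, hn⟩ := D.exists_mul_prod_card_le q
  calc (r : ENNReal) ≤ q := by exact_mod_cast hq
    _ = q * ((∏ k ∈ Finset.range n, ((D.C k).card : ENNReal)) * D.weight n) := by
        rw [weight, ENNReal.mul_inv_cancel, mul_one]
        · exact Finset.prod_ne_zero_iff.mpr fun k _ => D.card_ne_zero k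
        · exact ENNReal.prod_ne_top fun k _ => by simp
    _ ≤ (D.F n).card * D.weight n := by
        rw [← mul_assoc]
        exact mul_le_mul_left (by exact_mod_cast hn) _
    _ = D.measure (D.tower n) := (D.measure_tower n).symm
    _ ≤ _ := measure_mono (Set.subset_univ _)

instance : SigmaFinite D.measure := by
  refine ⟨⟨⟨fun n => D.tower n ∪ (⋃ n, D.tower n)ᶜ, fun _ => trivial, fun n => ?_, ?_⟩⟩⟩
  · refine (measure_union_le _ _).trans_lt ?_
    rw [measure_compl_iUnion_tower, add_zero]
    exact (D.measure_tower_ne_top n).lt_top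
  · rw [← Set.iUnion_union, Set.union_compl_self]

/-! ### Approximation by unions of levels -/

/-- Each level of a tower is either contained in or disjoint from a given earlier tower. -/
theorem level_subset_tower_of_mem {k n : ℕ} (hkn : k ≤ n) :
    ∀ {f : Fin d → ℤ} {x : D.Space}, f ∈ D.F n → x ∈ D.level n f → x ∈ D.tower k →
      D.level n f ⊆ D.tower k := by
  -- Following `x` through the successive cuttings of its level in tower `k` produces a level of
  -- tower `n` inside it; that level is the given one, since levels of tower `n` are disjoint.
  suffices h : ∀ (x : D.Space) (g : Fin d → ℤ), g ∈ D.F k → x ∈ D.level k g →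
      ∃ f ∈ D.F n, x ∈ D.level n f ∧ D.level n f ⊆ D.level k g by
    intro f x hf hx hxk
    simp only [tower, Set.mem_iUnion, exists_prop] at hxk
    obtain ⟨g, hg, hxg⟩ := hxk
    obtain ⟨f', hf', hx', hsub⟩ := h x g hg hxg
    rw [D.eq_of_mem_level hf hf' hx hx']
    exact hsub.trans (Set.subset_biUnion_of_mem (u := D.level k) hg)
  induction n, hkn using Nat.le_induction with
  | base => exact fun x g hg hx => ⟨g, hg, hx, subset_rfl⟩
  | succ n hkn ih =>
    intro x g hg hx
    obtain ⟨f, hf, hxf, hsub⟩ := ih x g hg hx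
    rw [D.level_eq_iUnion n f] at hxf hsub
    simp only [Set.mem_iUnion, exists_prop] at hxf
    obtain ⟨c, hc, hxc⟩ := hxf
    exact ⟨f + c, D.add_mem_F' hf hc, hxc,
      (Set.subset_biUnion_of_mem (u := fun c => D.level (n + 1) (f + c)) hc).trans hsub⟩

/-- The first `n` coordinates are constant on a level of tower `n`, so `E` contains or misses each
level. Intersecting with a fixed tower `k` discards the part of `E` outside the towers. -/
theorem exists_inter_tower_eq_biUnion_level {E : Set D.Space} {j : ℕ}
    (hE : ∀ x y : D.Space, (∀ i ≤ j, x i = y i) → x ∈ E → y ∈ E) {k n : ℕ} (hjn : j ≤ n)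
    (hkn : k ≤ n) : ∃ J ⊆ D.F n, E ∩ D.tower k = ⋃ f ∈ J, D.level n f := by
  classical
  refine ⟨(D.F n).filter fun f => D.level n f ⊆ E ∩ D.tower k, Finset.filter_subset _ _, ?_⟩
  apply Set.Subset.antisymm
  · rintro x ⟨hxE, hxk⟩
    have hxn := D.tower_mono hkn hxk
    simp only [tower, Set.mem_iUnion, exists_prop] at hxn
    obtain ⟨f, hf, hxf⟩ := hxn
    simp only [Set.mem_iUnion, exists_prop, Finset.mem_filter]
    refine ⟨f, ⟨hf, Set.subset_inter (fun y hy => ?_) ?_⟩, hxf⟩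
    · refine hE x y (fun i hi => ?_) hxE
      funext l
      rw [D.apply_eq_of_mem_level hxf (hi.trans hjn), D.apply_eq_of_mem_level hy (hi.trans hjn)]
    · exact D.level_subset_tower_of_mem hkn hf hxf hxk
  · exact Set.iUnion₂_subset fun f hf => (Finset.mem_filter.mp hf).2

theorem exists_symmDiff_determined_lt (ρ : Measure D.Space) [hρ : IsFiniteMeasure ρ]
    {B : Set D.Space} (hB : MeasurableSet B) {ε : ENNReal} (hε : 0 < ε) :
    ∃ (E : Set D.Space) (j : ℕ), (∀ x y : D.Space, (∀ i ≤ j, x i = y i) → x ∈ E → y ∈ E) ∧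
      ρ (B ∆ E) < ε :=
  @DirectionalRecurrence.exists_symmDiff_determined_lt (fun n => Fin d → ZMod (D.m n)) _ ρ hρ
    B hB _ hε

theorem eventually_exists_symmDiff_lt {B : Set D.Space} (hB : MeasurableSet B)
    (hB' : D.measure B < ⊤) {ε : ENNReal} (hε : 0 < ε) :
    ∀ᶠ n in atTop, ∃ J ⊆ D.F n, D.measure (B ∆ ⋃ f ∈ J, D.level n f) < ε := by
  have hε2 : 0 < ε / 2 := ENNReal.half_pos hε.ne'
  -- Almost every point lies in some tower, so a set of finite measure is nearly contained in one
  -- tower `k`. On it the measure is finite, and approximation by sets determined by finitely many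
  -- coordinates applies.
  obtain ⟨k, hk⟩ : ∃ k, D.measure (B \ D.tower k) < ε / 2 := by
    have ht : Tendsto (fun k => D.measure (B \ D.tower k)) atTop
        (𝓝 (D.measure (⋂ k, B \ D.tower k))) :=
      tendsto_measure_iInter_atTop (fun k => (hB.diff (D.measurableSet_tower k)).nullMeasurableSet)
        (fun _ _ h => Set.sdiff_subset_sdiff_right (D.tower_mono h))
        ⟨0, ((measure_mono Set.sdiff_subset).trans_lt hB').ne⟩
    rw [measure_mono_null (t := (⋃ n, D.tower n)ᶜ) (fun x hx => ?_)
      D.measure_compl_iUnion_tower] at ht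
    · exact (ht.eventually (gt_mem_nhds hε2)).exists
    · rw [Set.mem_compl_iff, Set.mem_iUnion, not_exists]
      exact fun n => (Set.mem_iInter.mp hx n).2
  have : IsFiniteMeasure (D.measure.restrict (D.tower k)) :=
    ⟨by rw [Measure.restrict_apply_univ]; exact (D.measure_tower_ne_top k).lt_top⟩
  obtain ⟨E, j, hE, hlt⟩ :=
    D.exists_symmDiff_determined_lt (D.measure.restrict (D.tower k)) hB hε2
  rw [Measure.restrict_apply' (D.measurableSet_tower k)] at hlt
  filter_upwards [eventually_ge_atTop j, eventually_ge_atTop k] with n hjn hkn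
  obtain ⟨J, hJ, hEJ⟩ := D.exists_inter_tower_eq_biUnion_level hE hjn hkn
  refine ⟨J, hJ, ?_⟩
  rw [← hEJ]
  calc D.measure (B ∆ (E ∩ D.tower k))
      ≤ D.measure (B \ D.tower k ∪ B ∆ E ∩ D.tower k) := measure_mono fun x hx => by
        simp only [Set.mem_symmDiff, Set.mem_inter_iff, Set.mem_union, Set.mem_sdiff] at hx ⊢
        tauto
    _ ≤ D.measure (B \ D.tower k) + D.measure (B ∆ E ∩ D.tower k) := measure_union_le _ _
    _ < ε / 2 + ε / 2 := ENNReal.add_lt_add hk hlt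
    _ = ε := ENNReal.add_halves ε

/-- The towers witness that the action is of rank one, if their shapes are translates of cubes. -/
theorem isRankOne (h : ℕ → ℕ) (e : ℕ → Fin d → ℤ)
    (hF : ∀ n f, f ∈ cube d (h n) ↔ f - e n ∈ D.F n) : IsRankOne d D.measure := by
  have hlev : ∀ n f, translateSet f (translateSet (-e n) (D.base n)) = D.level n (f - e n) := by
    intro n f
    rw [translateSet_translateSet, level, sub_eq_add_neg]
  refine ⟨fun n => translateSet (-e n) (D.base n), h, fun n => ⟨?_, ?_⟩, fun n => ?_, ?_⟩
  · exact measurableSet_translateSet (D.measurableSet_base n) _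
  · rw [measure_translateSet, measure_base]
    exact (D.weight_ne_top n).lt_top
  · intro f hf g hg hfg
    simp only [Function.onFun, hlev]
    exact D.pairwiseDisjoint_level n ((hF n f).mp hf) ((hF n g).mp hg)
      fun h => hfg (sub_left_injective h)
  · intro B hB hB' ε hε
    filter_upwards [D.eventually_exists_symmDiff_lt hB hB' hε] with n hn
    obtain ⟨J, hJ, hlt⟩ := hn
    classical
    refine ⟨J.image fun f => f + e n, fun f hf => ?_, ?_⟩
    · obtain ⟨g, hg, rfl⟩ := Finset.mem_image.mp hf
      rw [hF, add_sub_cancel_right]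
      exact hJ hg
    · simp only [hlev, Finset.set_biUnion_finset_image, add_sub_cancel_right]
      exact hlt

/-! ### Rigidity -/

/-- The piece `f + c` of level `f` is also the piece `(γ + f) + (c - γ)` of level `γ + f` whenever
`c - γ ∈ C n`. Only the other pieces can be lost. -/
theorem measure_level_diff_le (n : ℕ) (f γ : Fin d → ℤ) :
    D.measure (D.level n f \ D.level n (γ + f)) ≤
      ((D.C n).filter fun c => c - γ ∉ D.C n).card * D.weight (n + 1) := by
  have hsub : D.level n f \ D.level n (γ + f) ⊆
      ⋃ c ∈ (D.C n).filter fun c => c - γ ∉ D.C n, D.level (n + 1) (f + c) := by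
    rintro x ⟨hx, hx'⟩
    rw [D.level_eq_iUnion n] at hx hx'
    simp only [Set.mem_iUnion, exists_prop, not_exists, not_and, Finset.mem_filter] at hx hx' ⊢
    obtain ⟨c, hc, hxc⟩ := hx
    refine ⟨c, ⟨hc, fun hcγ => hx' _ hcγ ?_⟩, hxc⟩
    rwa [show γ + f + (c - γ) = f + c by abel]
  refine (measure_mono hsub).trans ((measure_biUnion_finset_le _ _).trans ?_)
  rw [← nsmul_eq_mul]
  refine Finset.sum_le_card_nsmul _ _ _ fun c _ => ?_
  rw [level, measure_translateSet, measure_base]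

theorem measure_biUnion_level_diff_le {n : ℕ} {J : Finset (Fin d → ℤ)} (hJ : J ⊆ D.F n)
    (γ : Fin d → ℤ) {q : ℕ} (hq : q ≠ 0)
    (hγ : q * ((D.C n).filter fun c => c - γ ∉ D.C n).card ≤ (D.C n).card) :
    D.measure ((⋃ f ∈ J, D.level n f) \ translateSet γ (⋃ f ∈ J, D.level n f)) ≤
      D.measure (⋃ f ∈ J, D.level n f) / q := by
  have hsub : (⋃ f ∈ J, D.level n f) \ translateSet γ (⋃ f ∈ J, D.level n f) ⊆
      ⋃ f ∈ J, D.level n f \ D.level n (γ + f) := by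
    rw [translateSet, Set.image_iUnion₂]
    rintro x ⟨hx, hx'⟩
    simp only [Set.mem_iUnion, exists_prop, not_exists, not_and] at hx hx' ⊢
    obtain ⟨f, hf, hxf⟩ := hx
    refine ⟨f, hf, hxf, fun h => hx' f hf ?_⟩
    rw [← D.translateSet_level] at h
    exact h
  rw [ENNReal.le_div_iff_mul_le (Or.inl (by simpa using hq)) (Or.inl (by simp)),
    D.measure_biUnion_level hJ]
  calc _ ≤ (J.card * (((D.C n).filter fun c => c - γ ∉ D.C n).card * D.weight (n + 1))) * q := by
        refine mul_le_mul_left ((measure_mono hsub).trans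
          ((measure_biUnion_finset_le _ _).trans ?_)) _
        rw [← nsmul_eq_mul]
        exact Finset.sum_le_card_nsmul _ _ _ fun f _ => D.measure_level_diff_le n f γ
    _ = J.card * ((q * ((D.C n).filter fun c => c - γ ∉ D.C n).card : ℕ) * D.weight (n + 1)) := by
        push_cast; ring
    _ ≤ J.card * ((D.C n).card * D.weight (n + 1)) := by gcongr
    _ = _ := by rw [card_mul_weight]

theorem tendsto_measure_inter_translateSet (γ : ℕ → Fin d → ℤ)
    (hγ : ∀ n, (n + 1) * ((D.C n).filter fun c => c - γ n ∉ D.C n).card ≤ (D.C n).card)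
    {A : Set D.Space} (hA : MeasurableSet A) (hA' : D.measure A < ⊤) :
    Tendsto (fun n => D.measure (A ∩ translateSet (γ n) A)) atTop (𝓝 (D.measure A)) := by
  have hdiff : Tendsto (fun n => D.measure (A \ translateSet (γ n) A)) atTop (𝓝 0) := by
    rw [ENNReal.tendsto_nhds_zero]
    intro ε hε
    -- The bound 1 keeps `D.measure B ≤ D.measure A + 1` for every approximating union `B`, so the
    -- loss `D.measure B / (n + 1)` tends to zero even though `B` depends on `n`.
    have hε3 : 0 < min (ε / 3) 1 := lt_min (ENNReal.div_pos hε.ne' (by simp)) one_pos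
    have hlim : Tendsto (fun n : ℕ => (D.measure A + 1) / ((n + 1 : ℕ) : ENNReal)) atTop (𝓝 0) := by
      have := (ENNReal.Tendsto.const_div (a := D.measure A + 1) ENNReal.tendsto_nat_nhds_top
        (Or.inr (ENNReal.add_ne_top.mpr ⟨hA'.ne, by simp⟩))).comp (tendsto_add_atTop_nat 1)
      rwa [ENNReal.div_top] at this
    filter_upwards [D.eventually_exists_symmDiff_lt hA hA' hε3,
      hlim.eventually (ge_mem_nhds (ENNReal.div_pos hε.ne' (by simp : (3 : ENNReal) ≠ ⊤)))]
      with n hn hn'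
    obtain ⟨J, hJ, hlt⟩ := hn
    set B := ⋃ f ∈ J, D.level n f
    have h1 : D.measure (A \ B) ≤ ε / 3 :=
      (measure_mono fun x hx => Or.inl hx).trans (hlt.le.trans (min_le_left _ _))
    have h2 : D.measure (B \ A) ≤ ε / 3 :=
      (measure_mono fun x hx => Or.inr hx).trans (hlt.le.trans (min_le_left _ _))
    have h2' : D.measure B ≤ D.measure A + 1 := by
      calc D.measure B ≤ D.measure (A ∪ A ∆ B) := measure_mono fun x hx => by
            by_cases hxA : x ∈ A
            · exact Or.inl hxA
            · exact Or.inr (Or.inr ⟨hx, hxA⟩)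
        _ ≤ _ := (measure_union_le _ _).trans
            (add_le_add le_rfl (hlt.le.trans (min_le_right _ _)))
    have h3 : D.measure (B \ translateSet (γ n) B) ≤ ε / 3 :=
      (D.measure_biUnion_level_diff_le hJ (γ n) n.succ_ne_zero (hγ n)).trans
        ((ENNReal.div_le_div_right h2' _).trans hn')
    calc D.measure (A \ translateSet (γ n) A)
        ≤ D.measure (A \ B ∪ (B \ translateSet (γ n) B ∪ translateSet (γ n) (B \ A))) :=
          measure_mono fun x hx => by
            simp only [Set.mem_union, Set.mem_sdiff, mem_translateSet] at hx ⊢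
            tauto
      _ ≤ D.measure (A \ B) + (D.measure (B \ translateSet (γ n) B) +
            D.measure (translateSet (γ n) (B \ A))) :=
          (measure_union_le _ _).trans (add_le_add le_rfl (measure_union_le _ _))
      _ ≤ ε / 3 + (ε / 3 + ε / 3) := by
          rw [measure_translateSet]
          exact add_le_add h1 (add_le_add h3 h2)
      _ = ε := by rw [← add_assoc, ENNReal.add_thirds]
  have heq : ∀ n, D.measure (A ∩ translateSet (γ n) A) =
      D.measure A - D.measure (A \ translateSet (γ n) A) := by
    intro n
    rw [← measure_inter_add_sdiff A (measurableSet_translateSet hA (γ n)),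
      ENNReal.add_sub_cancel_right ((measure_mono Set.sdiff_subset).trans_lt hA').ne]
  simp only [heq]
  simpa using ENNReal.Tendsto.sub tendsto_const_nhds hdiff (Or.inl hA'.ne)

end TowerData

/-- A rigid direction of a `σ`-finite action is a direction of recurrence. -/
theorem IsRigidAlong.isRecurrentAlong {d : ℕ} {X : Type*} [MeasurableSpace X]
    [AddAction (Fin d → ℤ) X] {μ : Measure X} [SigmaFinite μ] {θ : Directions d}
    (h : IsRigidAlong μ θ) : IsRecurrentAlong μ θ := by
  obtain ⟨γ, hγ, hdist, hrig⟩ := h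
  intro ε hε A hA hA0
  -- Rigidity speaks only of sets of finite measure, so `A` is replaced by a subset of finite
  -- positive measure.
  obtain ⟨B, hB, hBA, hB0, hBtop⟩ := μ.exists_subset_measure_lt_top hA hA0
  have h1 : ∀ᶠ n in atTop, 0 < μ (B ∩ translateSet (γ n) B) :=
    (hrig B hB hBtop).eventually (lt_mem_nhds hB0)
  have h2 : ∀ᶠ n in atTop, Metric.infDist (latticePoint (γ n))
      (θ.submodule : Set (EuclideanSpace ℝ (Fin d))) < ε :=
    hdist.eventually (gt_mem_nhds hε)
  have h3 : ∀ᶠ n in atTop, γ n ≠ 0 := hγ.eventually (eventually_cofinite_ne 0)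
  obtain ⟨n, hn1, hn2, hn3⟩ := (h1.and (h2.and h3)).exists
  obtain ⟨g, hg, hlt⟩ := (Metric.infDist_lt_iff ⟨0, θ.submodule.zero_mem⟩).mp hn2
  exact ⟨γ n, hn3, ⟨g, hg, hlt⟩, hn1.trans_le
    (measure_mono (Set.inter_subset_inter hBA (Set.image_mono hBA)))⟩

/-! ### The choice of the parameters -/

theorem mem_cube {d h : ℕ} {f : Fin d → ℤ} : f ∈ cube d h ↔ ∀ i, 0 ≤ f i ∧ f i < h := by
  simp [cube]

/-- Parameters of a construction with cubical towers of side about `2 m n / 3`, in which the `n`-th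
tower is copied along a box of side `l n` in the lattice `m n • ℤ^d`. -/
structure IsCubicParameters (m l : ℕ → ℕ) : Prop where
  m_zero : m 0 = 1
  m_succ : ∀ n, m (n + 1) = 3 * (m n * l n)
  l_pos : ∀ n, 0 < l n

namespace IsCubicParameters

variable {m l : ℕ → ℕ} (H : IsCubicParameters m l)
include H

theorem m_eq (n : ℕ) : m n = 3 ^ n * ∏ k ∈ Finset.range n, l k := by
  induction n with
  | zero => simp [H.m_zero]
  | succ n ih => rw [H.m_succ, ih, Finset.prod_range_succ]; ring

theorem pow_le_m (n : ℕ) : 3 ^ n ≤ m n := by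
  rw [H.m_eq]
  exact Nat.le_mul_of_pos_right _ (Finset.prod_pos fun k _ => H.l_pos k)

theorem m_pos (n : ℕ) : 0 < m n := (pow_pos three_pos n).trans_le (H.pow_le_m n)

theorem m_dvd_m {k n : ℕ} (h : k ≤ n) : m k ∣ m n := by
  induction n, h using Nat.le_induction with
  | base => rfl
  | succ n _ ih => exact ih.trans ⟨3 * l n, by rw [H.m_succ]; ring⟩

theorem eventually_lt_m (x : ℕ) : ∀ᶠ n in atTop, x < m n := by
  filter_upwards [eventually_gt_atTop x] with n hn
  exact hn.trans ((Nat.lt_pow_self (by norm_num)).trans_le (H.pow_le_m n))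

end IsCubicParameters

theorem smul_injective_of_pos {d m : ℕ} (hm : 0 < m) :
    Function.Injective fun t : Fin d → ℤ => (m : ℤ) • t :=
  smul_right_injective _ (by exact_mod_cast hm.ne')

/-- The cutting and stacking construction with the given parameters. -/
noncomputable def cubicTowers (d : ℕ) (hd : 1 ≤ d) {m l : ℕ → ℕ} (H : IsCubicParameters m l) :
    TowerData d where
  m := m
  C n := (cube d (l n)).image fun t => (m n : ℤ) • t
  -- The cube is centred at 0 so that it exhausts `ℤ^d`. Differences of its points have entries at
  -- most `2 m n / 3 < m n`, hence its points are incongruent modulo `m n`.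
  F n := Fintype.piFinset fun _ => Finset.Icc (-((m n / 3 : ℕ) : ℤ)) (m n / 3 : ℕ)
  nonempty_C n := ⟨_, Finset.mem_image_of_mem _
    (mem_cube.mpr fun i => ⟨le_refl 0, by exact_mod_cast H.l_pos n⟩)⟩
  zero_mem_F n := by
    simp only [Fintype.mem_piFinset, Finset.mem_Icc, Pi.zero_apply]
    intro i
    omega
  dvd_m h := H.m_dvd_m h
  dvd_C {n c} hc i := by
    obtain ⟨t, -, rfl⟩ := Finset.mem_image.mp hc
    exact ⟨t i, rfl⟩
  eq_of_dvd {n f g} hf hg h := by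
    simp only [Fintype.mem_piFinset, Finset.mem_Icc] at hf hg
    funext i
    have h1 := hf i
    have h2 := hg i
    have h3 := H.m_pos n
    exact sub_eq_zero.mp (Int.eq_zero_of_abs_lt_dvd (h i) (by rw [abs_lt]; omega))
  add_mem_F {n f g c} hf hg hc := by
    obtain ⟨t, ht, rfl⟩ := Finset.mem_image.mp hc
    simp only [Fintype.mem_piFinset, Finset.mem_Icc, Pi.add_apply, Pi.smul_apply, smul_eq_mul]
      at hf hg ⊢
    intro i
    have h1 := hf i
    have h2 := hg i
    obtain ⟨h3, h4⟩ := mem_cube.mp ht i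
    -- The next half-side is exactly `m n * l n`. The entries of `f + g` are at most `2 m n / 3` in
    -- size and those of `c` lie between `0` and `m n * l n - m n`.
    rw [H.m_succ, Nat.mul_div_cancel_left _ three_pos]
    have h5 : (m n : ℤ) * t i ≤ m n * l n - m n := by
      have : (m n : ℤ) * (t i + 1) ≤ m n * l n := by gcongr; omega
      linarith
    have h6 : 0 ≤ (m n : ℤ) * t i := by positivity
    have h7 : (m n : ℤ) ≤ m n * l n := by
      have := H.l_pos n
      exact_mod_cast Nat.le_mul_of_pos_right _ this
    push_cast at h1 h2 ⊢
    omega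
  eventually_mem_F γ := by
    simp only [Fintype.mem_piFinset, Finset.mem_Icc]
    refine eventually_all.mpr fun i => ?_
    filter_upwards [H.eventually_lt_m (3 * (γ i).natAbs)] with n hn
    omega
  exists_mul_prod_card_le q := by
    -- At stage `n = q + 1` the half-side is `3 ^ q * ∏ l k`, so the cube has at least `(3 ^ q) ^ d
    -- ≥ q` times as many points as `∏ |C k| = (∏ l k) ^ d`.
    refine ⟨q + 1, ?_⟩
    have h1 : ∀ n, ((cube d (l n)).image fun t => (m n : ℤ) • t).card = l n ^ d := fun n => by
      rw [Finset.card_image_of_injective _ (smul_injective_of_pos (H.m_pos n)), card_cube]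
    have h2 : m (q + 1) / 3 = 3 ^ q * ∏ k ∈ Finset.range (q + 1), l k := by
      rw [H.m_eq, pow_succ, mul_comm (3 ^ q) 3, mul_assoc, Nat.mul_div_cancel_left _ three_pos]
    simp only [h1, Fintype.card_piFinset, Int.card_Icc, Finset.prod_const, Finset.card_univ,
      Fintype.card_fin, Finset.prod_pow]
    calc q * (∏ k ∈ Finset.range (q + 1), l k) ^ d
        ≤ (3 ^ q) ^ d * (∏ k ∈ Finset.range (q + 1), l k) ^ d := by
          refine Nat.mul_le_mul_right _ ?_
          exact (Nat.lt_pow_self (by norm_num)).le.trans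
            (Nat.le_self_pow (by omega) _)
      _ = (m (q + 1) / 3) ^ d := by rw [h2, mul_pow]
      _ ≤ _ := Nat.pow_le_pow_left (by omega) d

theorem cubicTowers_isRankOne (d : ℕ) (hd : 1 ≤ d) {m l : ℕ → ℕ} (H : IsCubicParameters m l) :
    IsRankOne d (cubicTowers d hd H).measure := by
  refine TowerData.isRankOne _ (fun n => 2 * (m n / 3) + 1) (fun n _ => (m n / 3 : ℕ))
    fun n f => ?_
  simp only [cubicTowers, Fintype.mem_piFinset, Finset.mem_Icc, mem_cube, Pi.sub_apply]
  refine forall_congr' fun i => ?_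
  omega

theorem latticePoint_smul {d : ℕ} (k : ℤ) (p : Fin d → ℤ) :
    latticePoint (k • p) = (k : ℝ) • latticePoint p := by
  ext i
  simp [latticePoint]

/-- If the boxes along which the towers are copied are large enough, then every direction is
rigid. -/
theorem cubicTowers_isRigidAlong (d : ℕ) (hd : 1 ≤ d) {m l : ℕ → ℕ} (H : IsCubicParameters m l)
    (θ : Directions d)
    (hθ : ∀ n, ∃ p : Fin d → ℤ, p ≠ 0 ∧
      (∃ g ∈ θ.submodule, dist (latticePoint p) g ≤ 1 / ((n + 1) * m n)) ∧
      (n + 1) * ((cube d (l n)).filter fun t => t - p ∉ cube d (l n)).card ≤ (cube d (l n)).card) :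
    IsRigidAlong (cubicTowers d hd H).measure θ := by
  classical
  set D := cubicTowers d hd H
  choose p hp0 hnear hcard using hθ
  choose g hg hdist using hnear
  refine ⟨fun n => (m n : ℤ) • p n, ?_, ?_, fun A hA hA' =>
    D.tendsto_measure_inter_translateSet _ (fun n => ?_) hA hA'⟩
  · rw [Tendsto, le_cofinite_iff_eventually_ne]
    intro x
    rw [eventually_map]
    filter_upwards [D.eventually_mem_F x] with n hn hx
    -- A fixed `x` lies in `F n` for all large `n`, and the only multiple of `m n` in `F n` is `0`,
    -- whereas `m n • p n ≠ 0`.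
    have hx0 : x = 0 := D.eq_of_dvd hn (D.zero_mem_F n) fun i => ⟨p n i, by simp [← hx, D, cubicTowers]⟩
    refine hp0 n (smul_injective_of_pos (H.m_pos n) ?_)
    simp only [smul_zero]
    rw [hx, hx0]
  · refine squeeze_zero (fun n => Metric.infDist_nonneg) (fun n => ?_)
      tendsto_one_div_add_atTop_nhds_zero_nat
    refine (Metric.infDist_le_dist_of_mem (θ.submodule.smul_mem (m n : ℝ) (hg n))).trans ?_
    have hm : (0 : ℝ) < m n := by exact_mod_cast H.m_pos n
    rw [latticePoint_smul, Int.cast_natCast, dist_smul₀, Real.norm_of_nonneg hm.le]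
    calc (m n : ℝ) * dist (latticePoint (p n)) (g n) ≤ m n * (1 / ((n + 1) * m n)) := by
          gcongr; exact hdist n
      _ = 1 / (n + 1) := by field_simp
  · have hinj := smul_injective_of_pos (d := d) (H.m_pos n)
    have hC : ∀ t, (m n : ℤ) • t ∈ D.C n ↔ t ∈ cube d (l n) := fun t =>
      hinj.mem_finset_image
    have hsub : ((D.C n).filter fun c => c - (m n : ℤ) • p n ∉ D.C n) ⊆
        ((cube d (l n)).filter fun t => t - p n ∉ cube d (l n)).image fun t => (m n : ℤ) • t := by
      intro c hc
      obtain ⟨hc1, hc2⟩ := Finset.mem_filter.mp hc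
      obtain ⟨t, ht, rfl⟩ := Finset.mem_image.mp hc1
      refine Finset.mem_image_of_mem _ (Finset.mem_filter.mpr ⟨ht, ?_⟩)
      rwa [← smul_sub, hC] at hc2
    calc _ ≤ (n + 1) * ((cube d (l n)).filter fun t => t - p n ∉ cube d (l n)).card :=
          Nat.mul_le_mul_left _ ((Finset.card_le_card hsub).trans Finset.card_image_le)
      _ ≤ _ := hcard n
      _ = (D.C n).card := (Finset.card_image_of_injective _ hinj).symm

theorem exists_cubicParameters (d : ℕ) : ∃ m l : ℕ → ℕ, IsCubicParameters m l ∧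
    ∀ (θ : Directions d) n, ∃ p : Fin d → ℤ, p ≠ 0 ∧
      (∃ g ∈ θ.submodule, dist (latticePoint p) g ≤ 1 / ((n + 1) * m n)) ∧
      (n + 1) * ((cube d (l n)).filter fun t => t - p ∉ cube d (l n)).card ≤
        (cube d (l n)).card := by
  -- Here `k` stands for the future value of `m n`. Choosing the side for every `k` beforehand
  -- allows `m` to be defined by recursion, as `l n` depends on `m n` and `m (n + 1)` on both. The
  -- value `k = 0`, which never occurs, receives a dummy side.
  have hex : ∀ n k : ℕ, ∃ L : ℕ, 0 < L ∧ (0 < k → ∀ θ : Directions d, ∃ p : Fin d → ℤ, p ≠ 0 ∧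
      (∃ g ∈ θ.submodule, dist (latticePoint p) g ≤ 1 / ((n + 1) * k)) ∧
      (n + 1) * ((cube d L).filter fun t => t - p ∉ cube d L).card ≤ (cube d L).card) := by
    intro n k
    rcases Nat.eq_zero_or_pos k with rfl | hk
    · exact ⟨1, one_pos, fun h => absurd h (lt_irrefl 0)⟩
    · obtain ⟨R, hR⟩ := exists_bound_int_vector_near_line d
        (ε := 1 / ((n + 1) * k)) (by positivity)
      obtain ⟨L, hL, hcube⟩ := exists_cube_almost_invariant d R (n + 1)
      refine ⟨L, hL, fun _ θ => ?_⟩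
      obtain ⟨p, hp0, hpR, hp⟩ := hR θ
      exact ⟨p, hp0, hp, hcube p hpR⟩
  choose L hL hprop using hex
  let m : ℕ → ℕ := fun n => Nat.rec 1 (fun n k => 3 * (k * L n k)) n
  have H : IsCubicParameters m fun n => L n (m n) := ⟨rfl, fun _ => rfl, fun n => hL n _⟩
  exact ⟨m, _, H, fun θ n => hprop n (m n) (H.m_pos n) θ⟩

end DirectionalRecurrence

theorem theorem4p3 (d : ℕ) (hd : 1 ≤ d) :
    (∃ (X : Type) (_ : MeasurableSpace X) (_ : StandardBorelSpace X)
        (_ : AddAction (Fin d → ℤ) X) (_ : MeasurableConstVAdd (Fin d → ℤ) X)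
        (μ : Measure X) (_ : SigmaFinite μ) (_ : VAddInvariantMeasure (Fin d → ℤ) X μ),
        μ Set.univ = ⊤ ∧
        DirectionalRecurrence.IsFreeAction d X ∧
        DirectionalRecurrence.IsRankOne d μ ∧
        DirectionalRecurrence.recurrentDirections d μ = Set.univ) ∧
    (∃ (X : Type) (_ : MeasurableSpace X) (_ : StandardBorelSpace X)
        (_ : AddAction (Fin d → ℤ) X) (_ : MeasurableConstVAdd (Fin d → ℤ) X)
        (μ : Measure X) (_ : SigmaFinite μ) (_ : VAddInvariantMeasure (Fin d → ℤ) X μ),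
        μ Set.univ = ⊤ ∧
        DirectionalRecurrence.IsFreeAction d X ∧
        DirectionalRecurrence.IsRankOne d μ ∧
        DirectionalRecurrence.rigidDirections d μ = Set.univ) := by
  obtain ⟨m, l, H, hprop⟩ := DirectionalRecurrence.exists_cubicParameters d
  let D := DirectionalRecurrence.cubicTowers d hd H
  have hrig : ∀ θ, DirectionalRecurrence.IsRigidAlong D.measure θ := fun θ =>
    DirectionalRecurrence.cubicTowers_isRigidAlong d hd H θ (hprop θ)
  exact ⟨⟨D.Space, inferInstance, inferInstance, inferInstance, inferInstance, D.measure,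
      inferInstance, inferInstance, D.measure_univ_eq_top, D.isFreeAction,
      DirectionalRecurrence.cubicTowers_isRankOne d hd H,
      Set.eq_univ_of_forall fun θ => (hrig θ).isRecurrentAlong⟩,
    ⟨D.Space, inferInstance, inferInstance, inferInstance, inferInstance, D.measure,
      inferInstance, inferInstance, D.measure_univ_eq_top, D.isFreeAction,
      DirectionalRecurrence.cubicTowers_isRankOne d hd H, Set.eq_univ_of_forall hrig⟩⟩
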